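/- Let $\delta,\gamma\in\mathbb R$, and let $y:\mathbb R\to\mathbb R$ be the solution of the Duffing problem $$\ddot y(t)+y(t)+y(t)^3=0,\qquad y(0)=\delta,\quad \dot y(0)=0 .$$ Consider the equation $$\ddot\xi(t)+\big(\gamma+y(t)^2\big)\,\xi(t)=0,\qquad t\in\mathbb R. \tag{1}$$ The trivial solution $\xi\equiv0$ of (1) is called *stable* if for every $\varepsilon>0$ there is $\eta>0$ such that every solution $\xi$ of (1) with $|\xi(0)|<\eta$ and $|\dot\xi(0)|<\eta$ satisfies $|\xi(t)|<\varepsilon$ and $|\dot\xi(t)|<\varepsilon$ for all $t\ge0$; it is called *unstable* otherwise. (a) If $-\frac{\delta^2}{2}<\gamma<1$, then the trivial solution of (1) is stable, and all solutions of (1) are bounded on $\mathbb R$. (b) If $\gamma<-\frac{\delta^2}{2}$, then the trivial solution of (1) is unstable, and (1) has a solution that is unbounded on $\mathbb R$. -/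

import Mathlib

/-- `y` is the (global) solution of the Duffing equation `y'' + y + y³ = 0` on `ℝ` with initial
values `y(0) = δ`, `y'(0) = 0`. -/
structure IsDuffingSolution (δ : ℝ) (y : ℝ → ℝ) : Prop where
  differentiable : Differentiable ℝ y
  ode : ∀ t : ℝ, HasDerivAt (deriv y) (-(y t + y t ^ 3)) t
  init : y 0 = δ
  init_deriv : deriv y 0 = 0

/-- `ξ` is a (classical, global) solution of the Hill equation `ξ'' + p(t) ξ = 0` on `ℝ`. -/
structure IsHillSolution (p ξ : ℝ → ℝ) : Prop where
  differentiable : Differentiable ℝ ξ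
  ode : ∀ t : ℝ, HasDerivAt (deriv ξ) (-(p t * ξ t)) t

/-- Lyapunov stability of the trivial solution of `ξ'' + p(t) ξ = 0` in the phase plane
`(ξ, ξ')`: solutions that start close to `(0, 0)` at time `0` stay close to it
for all `t ≥ 0`. -/
def TrivialSolutionStable (p : ℝ → ℝ) : Prop :=
  ∀ ε : ℝ, 0 < ε → ∃ η : ℝ, 0 < η ∧ ∀ ξ : ℝ → ℝ, IsHillSolution p ξ →
    |ξ 0| < η → |deriv ξ 0| < η → ∀ t : ℝ, 0 ≤ t → |ξ t| < ε ∧ |deriv ξ t| < ε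

/-- Every solution of `ξ'' + p(t) ξ = 0` is bounded on `ℝ`. -/
def AllSolutionsBounded (p : ℝ → ℝ) : Prop :=
  ∀ ξ : ℝ → ℝ, IsHillSolution p ξ → ∃ C : ℝ, ∀ t : ℝ, |ξ t| ≤ C

section Duffing

variable {δ : ℝ} {y : ℝ → ℝ}

/-! Products `X` of two solutions of `ξ'' + pξ = 0` satisfy `X''' + 4pX' + 2p'X = 0`; for `p = γ +
y²` this has the explicit solution `X = y² + 2(1 - γ)`, positive for `γ < 1`. With first integral `d
= XX''/2 - X'²/4 + pX²`, the substitution `η = ξ/√X`, `ds = dt/X` turns the equation into `d²η/ds² +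
dη = 0`. As `γ < 1`, the sign of `d` is that of `δ² + 2γ`: oscillation if `d > 0`
(`quadratic_invariant` is the energy of `η`), exponential growth if `d < 0`. -/

theorem IsDuffingSolution.hasDerivAt (hy : IsDuffingSolution δ y) (t : ℝ) :
    HasDerivAt y (deriv y t) t :=
  (hy.differentiable t).hasDerivAt

theorem IsHillSolution.hasDerivAt {p ξ : ℝ → ℝ} (h : IsHillSolution p ξ) (t : ℝ) :
    HasDerivAt ξ (deriv ξ t) t :=
  (h.differentiable t).hasDerivAt

theorem eq_of_forall_hasDerivAt_zero {f : ℝ → ℝ} (h : ∀ t, HasDerivAt f 0 t) (s t : ℝ) :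
    f s = f t :=
  is_const_of_deriv_eq_zero (fun t => (h t).differentiableAt) (fun t => (h t).deriv) s t

/-- Conservation of energy for the Duffing oscillator. -/
theorem IsDuffingSolution.energy (hy : IsDuffingSolution δ y) (t : ℝ) :
    deriv y t ^ 2 + y t ^ 2 + y t ^ 4 / 2 = δ ^ 2 + δ ^ 4 / 2 := by
  have h : ∀ t, HasDerivAt (fun t => deriv y t ^ 2 + y t ^ 2 + y t ^ 4 / 2) 0 t := fun t => by
    have h := (((hy.ode t).pow 2).add ((hy.hasDerivAt t).pow 2)).add
      (((hy.hasDerivAt t).pow 4).div_const 2)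
    refine h.congr_deriv ?_
    norm_num
    ring
  have := eq_of_forall_hasDerivAt_zero h t 0
  simpa [hy.init, hy.init_deriv] using this

theorem IsDuffingSolution.sq_le (hy : IsDuffingSolution δ y) (t : ℝ) :
    y t ^ 2 ≤ δ ^ 2 + δ ^ 4 / 2 := by
  nlinarith [hy.energy t, sq_nonneg (deriv y t), sq_nonneg (y t ^ 2)]

theorem IsDuffingSolution.abs_mul_deriv_le (hy : IsDuffingSolution δ y) (t : ℝ) :
    |y t * deriv y t| ≤ δ ^ 2 + δ ^ 4 / 2 := by
  have h := hy.energy t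
  rw [abs_le]
  constructor <;>
    nlinarith [sq_nonneg (y t + deriv y t), sq_nonneg (y t - deriv y t), sq_nonneg (y t ^ 2),
      sq_nonneg (y t), sq_nonneg (deriv y t)]

/-! ### The Floquet product and its first integral -/

/-- The product of the two Floquet solutions of `ξ'' + (γ + y²) ξ = 0`. -/
def floquetProduct (γ : ℝ) (y : ℝ → ℝ) (t : ℝ) : ℝ := y t ^ 2 + 2 * (1 - γ)

/-- The constant value of `X X'' / 2 - X'² / 4 + (γ + y²) X²` for `X = floquetProduct γ y`. -/
def floquetDiscriminant (δ γ : ℝ) : ℝ :=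
  (δ ^ 2 + 2 * (1 - γ)) * (1 - γ) * (δ ^ 2 + 2 * γ)

theorem floquetProduct_lower {γ : ℝ} (y : ℝ → ℝ) (t : ℝ) :
    2 * (1 - γ) ≤ floquetProduct γ y t := by
  unfold floquetProduct
  nlinarith [sq_nonneg (y t)]

theorem IsDuffingSolution.floquetProduct_le (hy : IsDuffingSolution δ y) (γ t : ℝ) :
    floquetProduct γ y t ≤ δ ^ 2 + δ ^ 4 / 2 + 2 * (1 - γ) := by
  unfold floquetProduct
  linarith [hy.sq_le t]

theorem floquetProduct_pos {γ : ℝ} (hγ : γ < 1) (y : ℝ → ℝ) (t : ℝ) :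
    0 < floquetProduct γ y t := by
  linarith [floquetProduct_lower (γ := γ) y t]

theorem IsDuffingSolution.hasDerivAt_floquetProduct (hy : IsDuffingSolution δ y) (γ t : ℝ) :
    HasDerivAt (floquetProduct γ y) (2 * (y t * deriv y t)) t := by
  have h := ((hy.hasDerivAt t).pow 2).add_const (2 * (1 - γ))
  refine h.congr_deriv ?_
  norm_num
  ring

theorem IsDuffingSolution.hasDerivAt_mul_deriv (hy : IsDuffingSolution δ y) (t : ℝ) :
    HasDerivAt (fun t => y t * deriv y t)
      (deriv y t * deriv y t + y t * -(y t + y t ^ 3)) t :=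
  (hy.hasDerivAt t).mul (hy.ode t)

/-- Here `y * y'` is `X'/2` and its derivative is `X''/2`. The identity is the Duffing energy law
scaled by `2(1 - γ)`. -/
theorem IsDuffingSolution.floquetDiscriminant_eq (hy : IsDuffingSolution δ y) (γ t : ℝ) :
    floquetProduct γ y t * (deriv y t * deriv y t + y t * -(y t + y t ^ 3)) -
      (y t * deriv y t) ^ 2 + (γ + y t ^ 2) * floquetProduct γ y t ^ 2 =
      floquetDiscriminant δ γ := by
  unfold floquetProduct floquetDiscriminant
  linear_combination (2 * (1 - γ)) * hy.energy t

/-- The quadratic form conserved along solutions of `ξ'' + (γ + y²) ξ = 0`. -/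
theorem IsHillSolution.quadratic_invariant (hy : IsDuffingSolution δ y) {γ : ℝ} (hγ : γ < 1)
    {ξ : ℝ → ℝ} (hξ : IsHillSolution (fun t => γ + y t ^ 2) ξ) (t : ℝ) :
    ((floquetProduct γ y t * deriv ξ t - y t * deriv y t * ξ t) ^ 2 +
      floquetDiscriminant δ γ * ξ t ^ 2) / floquetProduct γ y t =
    floquetProduct γ y 0 * deriv ξ 0 ^ 2 +
      floquetDiscriminant δ γ * ξ 0 ^ 2 / floquetProduct γ y 0 := by
  have h : ∀ t, HasDerivAt (fun t =>
      ((floquetProduct γ y t * deriv ξ t - y t * deriv y t * ξ t) ^ 2 +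
        floquetDiscriminant δ γ * ξ t ^ 2) / floquetProduct γ y t) 0 t := fun t => by
    have hX := hy.hasDerivAt_floquetProduct γ t
    have h0 := (floquetProduct_pos hγ y t).ne'
    have h := (((((hX.mul (hξ.ode t)).sub
      ((hy.hasDerivAt_mul_deriv t).mul (hξ.hasDerivAt t))).pow 2).add
      (((hξ.hasDerivAt t).pow 2).const_mul (floquetDiscriminant δ γ))).div hX h0)
    refine h.congr_deriv ?_
    rw [div_eq_zero_iff]
    left
    simp only [Pi.mul_apply, Pi.sub_apply, Pi.add_apply, Pi.pow_apply]
    -- Evaluating the constant at the current time makes the numerator vanish identically.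
    rw [← hy.floquetDiscriminant_eq γ t]
    norm_num
    ring
  have := eq_of_forall_hasDerivAt_zero h t 0
  rw [this]
  have h0 := (floquetProduct_pos hγ y 0).ne'
  rw [hy.init_deriv]
  field_simp
  ring

theorem abs_le_of_sq_le_mul_sq {a b c : ℝ} (hc : 0 ≤ c) (hb : 0 ≤ b) (h : a ^ 2 ≤ c * b ^ 2) :
    |a| ≤ √c * b := by
  have : |a| ≤ |√c * b| := by
    rw [← sq_le_sq, mul_pow, Real.sq_sqrt hc]
    exact h
  rwa [abs_of_nonneg (mul_nonneg (Real.sqrt_nonneg c) hb)] at this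

/-! ### Stability for positive discriminant -/

/-- Inside the band, solutions are bounded uniformly by their initial data. -/
theorem IsDuffingSolution.exists_uniform_bound (hy : IsDuffingSolution δ y) {γ : ℝ}
    (hγ : -(δ ^ 2 / 2) < γ) (hγ1 : γ < 1) :
    ∃ C : ℝ, 0 < C ∧ ∀ ξ : ℝ → ℝ, IsHillSolution (fun t => γ + y t ^ 2) ξ → ∀ t,
      |ξ t| ≤ C * (|ξ 0| + |deriv ξ 0|) ∧ |deriv ξ t| ≤ C * (|ξ 0| + |deriv ξ 0|) := by
  set d := floquetDiscriminant δ γ with hd_def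
  set E := δ ^ 2 + δ ^ 4 / 2 with hE_def
  set m := 2 * (1 - γ) with hm_def
  have hm : 0 < m := by linarith
  have hE : 0 ≤ E := by positivity
  have hd : 0 < d := by
    have h1 : 0 < 1 - γ := by linarith
    have h2 : 0 < δ ^ 2 + 2 * γ := by linarith
    have h3 : 0 < δ ^ 2 + 2 * (1 - γ) := by positivity
    exact mul_pos (mul_pos h3 h1) h2
  set X₀ := floquetProduct γ y 0 with hX₀_def
  have hX₀ : 0 < X₀ := floquetProduct_pos hγ1 y 0
  -- Upper bound for `X` times the bound on the invariant for data of size one.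
  set B := (E + m) * (X₀ + d / X₀) with hB_def
  have hB : 0 ≤ B := by positivity
  set C₁ := √(B / d) with hC₁_def
  set C₂ := (√B + E * C₁) / m with hC₂_def
  have hC₁ : 0 ≤ C₁ := Real.sqrt_nonneg _
  have hC₂ : 0 ≤ C₂ := by positivity
  refine ⟨C₁ + C₂ + 1, by positivity, fun ξ hξ t => ?_⟩
  set S := |ξ 0| + |deriv ξ 0| with hS_def
  have hS : 0 ≤ S := by positivity
  have hX := floquetProduct_pos hγ1 y t
  have hXm : m ≤ floquetProduct γ y t := floquetProduct_lower y t
  have hXM : floquetProduct γ y t ≤ E + m := hy.floquetProduct_le γ t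
  have hq : (floquetProduct γ y t * deriv ξ t - y t * deriv y t * ξ t) ^ 2 + d * ξ t ^ 2 ≤
      B * S ^ 2 := by
    have hI := hξ.quadratic_invariant hy hγ1 t
    rw [div_eq_iff hX.ne'] at hI
    rw [hI]
    have hξS : ξ 0 ^ 2 ≤ S ^ 2 := by
      rw [← sq_abs (ξ 0)]
      gcongr
      linarith [abs_nonneg (deriv ξ 0)]
    have hξS' : deriv ξ 0 ^ 2 ≤ S ^ 2 := by
      rw [← sq_abs (deriv ξ 0)]
      gcongr
      linarith [abs_nonneg (ξ 0)]
    calc (X₀ * deriv ξ 0 ^ 2 + d * ξ 0 ^ 2 / X₀) * floquetProduct γ y t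
        ≤ (X₀ * S ^ 2 + d * S ^ 2 / X₀) * (E + m) := by gcongr
      _ = B * S ^ 2 := by rw [hB_def]; ring
  have h₁ : |ξ t| ≤ C₁ * S := by
    refine abs_le_of_sq_le_mul_sq (by positivity) hS ?_
    rw [div_mul_eq_mul_div, le_div_iff₀ hd]
    nlinarith [sq_nonneg (floquetProduct γ y t * deriv ξ t - y t * deriv y t * ξ t)]
  have h₂ : |deriv ξ t| ≤ C₂ * S := by
    have h₃ : |floquetProduct γ y t * deriv ξ t - y t * deriv y t * ξ t| ≤ √B * S :=
      abs_le_of_sq_le_mul_sq hB hS (by nlinarith [mul_nonneg hd.le (sq_nonneg (ξ t))])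
    have h₄ : |y t * deriv y t * ξ t| ≤ E * (C₁ * S) := by
      rw [abs_mul]
      exact mul_le_mul (hy.abs_mul_deriv_le t) h₁ (abs_nonneg _) hE
    have h₅ : m * |deriv ξ t| ≤ √B * S + E * (C₁ * S) := by
      calc m * |deriv ξ t| ≤ floquetProduct γ y t * |deriv ξ t| := by gcongr
        _ = |(floquetProduct γ y t * deriv ξ t - y t * deriv y t * ξ t) +
              y t * deriv y t * ξ t| := by
            rw [sub_add_cancel, abs_mul, abs_of_pos hX]
        _ ≤ _ := (abs_add_le _ _).trans (add_le_add h₃ h₄)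
    rw [hC₂_def, div_mul_eq_mul_div, le_div_iff₀ hm]
    linarith
  have hC₁S := mul_nonneg hC₁ hS
  have hC₂S := mul_nonneg hC₂ hS
  constructor <;> linarith

theorem trivialSolutionStable_of_uniform_bound {p : ℝ → ℝ} {C : ℝ} (hC : 0 < C)
    (h : ∀ ξ : ℝ → ℝ, IsHillSolution p ξ → ∀ t,
      |ξ t| ≤ C * (|ξ 0| + |deriv ξ 0|) ∧ |deriv ξ t| ≤ C * (|ξ 0| + |deriv ξ 0|)) :
    TrivialSolutionStable p := by
  intro ε hε
  refine ⟨ε / (2 * C), by positivity, fun ξ hξ h0 h1 t _ => ?_⟩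
  have hlt : C * (|ξ 0| + |deriv ξ 0|) < ε := by
    calc C * (|ξ 0| + |deriv ξ 0|) < C * (ε / (2 * C) + ε / (2 * C)) := by gcongr
      _ = ε := by field_simp; ring
  exact ⟨(h ξ hξ t).1.trans_lt hlt, (h ξ hξ t).2.trans_lt hlt⟩

theorem IsHillSolution.const_mul {p ξ : ℝ → ℝ} (h : IsHillSolution p ξ) (c : ℝ) :
    IsHillSolution p (fun t => c * ξ t) where
  differentiable := h.differentiable.const_mul c
  ode t := by
    have hd : deriv (fun t => c * ξ t) = fun t => c * deriv ξ t :=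
      funext fun s => ((h.hasDerivAt s).const_mul c).deriv
    rw [hd]
    refine ((h.ode t).const_mul c).congr_deriv ?_
    ring

/-- A solution that is unbounded on the forward half-line destroys Lyapunov stability. -/
theorem IsHillSolution.not_trivialSolutionStable {p ξ : ℝ → ℝ} (h : IsHillSolution p ξ)
    (hu : ∀ C : ℝ, ∃ t, 0 ≤ t ∧ C < |ξ t|) : ¬ TrivialSolutionStable p := by
  intro hs
  obtain ⟨η, hη, H⟩ := hs 1 one_pos
  set S := |ξ 0| + |deriv ξ 0| + 1 with hS_def
  have hS : 0 < S := by positivity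
  set c := η / (2 * S) with hc_def
  have hc : 0 < c := by positivity
  have hcS : c * S < η := by
    rw [hc_def, div_mul_eq_mul_div, div_lt_iff₀ (by positivity)]
    nlinarith
  -- At such a time the solution rescaled by `c` exceeds `ε = 1`.
  obtain ⟨t, ht, htu⟩ := hu (1 / c)
  have hd : deriv (fun t => c * ξ t) 0 = c * deriv ξ 0 :=
    ((h.hasDerivAt 0).const_mul c).deriv
  have hb := (H _ (h.const_mul c) ?_ ?_ t ht).1
  · rw [abs_mul, abs_of_pos hc] at hb
    rw [div_lt_iff₀ hc] at htu
    linarith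
  · rw [abs_mul, abs_of_pos hc]
    refine lt_of_le_of_lt (mul_le_mul_of_nonneg_left ?_ hc.le) hcS
    linarith [abs_nonneg (deriv ξ 0)]
  · rw [hd, abs_mul, abs_of_pos hc]
    refine lt_of_le_of_lt (mul_le_mul_of_nonneg_left ?_ hc.le) hcS
    linarith [abs_nonneg (ξ 0)]

/-! ### Instability for negative discriminant -/

/-- Below the band there is an exponentially growing solution. -/
theorem IsDuffingSolution.exists_unbounded (hy : IsDuffingSolution δ y) {γ : ℝ}
    (hγ : γ < -(δ ^ 2 / 2)) :
    ∃ ξ : ℝ → ℝ, IsHillSolution (fun t => γ + y t ^ 2) ξ ∧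
      ∀ C : ℝ, ∃ t, 0 ≤ t ∧ C < |ξ t| := by
  have hγ1 : γ < 1 := by nlinarith [sq_nonneg δ]
  have hd : floquetDiscriminant δ γ < 0 := by
    have h1 : 0 < 1 - γ := by linarith
    have h2 : δ ^ 2 + 2 * γ < 0 := by linarith
    have h3 : 0 < δ ^ 2 + 2 * (1 - γ) := by positivity
    exact mul_neg_of_pos_of_neg (mul_pos h3 h1) h2
  set κ := √(-floquetDiscriminant δ γ) with hκ_def
  have hκ : 0 < κ := Real.sqrt_pos.2 (by linarith)
  have hκ2 : κ ^ 2 = -floquetDiscriminant δ γ := Real.sq_sqrt (by linarith)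
  set X := floquetProduct γ y with hX_def
  have hX : ∀ t, 0 < X t := floquetProduct_pos hγ1 y
  have hX' : ∀ t, HasDerivAt X (2 * (y t * deriv y t)) t := hy.hasDerivAt_floquetProduct γ
  have hXinv : Continuous fun t => (X t)⁻¹ :=
    (continuous_iff_continuousAt.2 fun t => (hX' t).continuousAt).inv₀ fun t => (hX t).ne'
  set τ : ℝ → ℝ := fun t => ∫ s in (0 : ℝ)..t, (X s)⁻¹ with hτ_def
  have hτ : ∀ t, HasDerivAt τ (X t)⁻¹ t := fun t =>
    intervalIntegral.integral_hasDerivAt_right (hXinv.intervalIntegrable _ _)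
      (hXinv.stronglyMeasurableAtFilter _ _) hXinv.continuousAt
  -- The growing Floquet solution `√X * exp (κ ∫ 1/X)`.
  set ξ : ℝ → ℝ := fun t => Real.exp (Real.log (X t) / 2 + κ * τ t) with hξ_def
  -- Logarithmic derivative of `ξ`; the Riccati equation `g' + g² + p = 0` amounts to `κ² = -d`.
  set g : ℝ → ℝ := fun t => (y t * deriv y t + κ) / X t with hg_def
  have hξ : ∀ t, HasDerivAt ξ (g t * ξ t) t := fun t => by
    have h := ((((hX' t).log (hX t).ne').div_const 2).add ((hτ t).const_mul κ)).exp
    refine h.congr_deriv ?_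
    have := (hX t).ne'
    simp only [hg_def, hξ_def, Pi.add_apply]
    field_simp
  have hξd : deriv ξ = fun t => g t * ξ t := funext fun t => (hξ t).deriv
  refine ⟨ξ, ⟨fun t => (hξ t).differentiableAt, fun t => ?_⟩, fun C => ?_⟩
  · rw [hξd]
    have hg := ((hy.hasDerivAt_mul_deriv t).add_const κ).div (hX' t) (hX t).ne'
    refine (hg.mul (hξ t)).congr_deriv ?_
    have h0 := (hX t).ne'
    have hD := hy.floquetDiscriminant_eq γ t
    rw [← hX_def] at hD
    simp only [hg_def, Pi.div_apply]
    field_simp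
    linear_combination ξ t * (hκ2 + hD)
  · set M := δ ^ 2 + δ ^ 4 / 2 + 2 * (1 - γ) with hM_def
    have hXM : ∀ t, X t ≤ M := hy.floquetProduct_le γ
    have hM : 0 < M := (hX 0).trans_le (hXM 0)
    set L := Real.log (2 * (1 - γ)) / 2 with hL_def
    have hL : ∀ t, L ≤ Real.log (X t) / 2 := fun t => by
      have := Real.log_le_log (by linarith) (floquetProduct_lower (γ := γ) y t)
      rw [hL_def]
      linarith
    have hτM : ∀ t, 0 ≤ t → t / M ≤ τ t := fun t ht => by
      have := intervalIntegral.integral_mono_on (μ := MeasureTheory.volume) ht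
        (intervalIntegrable_const (c := M⁻¹))
        (hXinv.intervalIntegrable 0 t) (fun s _ => inv_anti₀ (hX s) (hXM s))
      simpa [div_eq_mul_inv] using this
    -- Since `τ t ≥ t / M`, the exponent is at least `|C| + |L| + L ≥ |C|`.
    set t := (|C| + |L|) * M / κ with ht_def
    have ht : 0 ≤ t := by positivity
    refine ⟨t, ht, ?_⟩
    have hκτ : |C| + |L| ≤ κ * τ t := by
      calc |C| + |L| = κ * (t / M) := by rw [ht_def]; field_simp
        _ ≤ κ * τ t := by gcongr; exact hτM t ht
    calc C ≤ |C| := le_abs_self C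
      _ < |C| + 1 := lt_add_one _
      _ ≤ Real.exp |C| := Real.add_one_le_exp _
      _ ≤ ξ t := Real.exp_le_exp.2 (by linarith [hL t, neg_abs_le L])
      _ ≤ |ξ t| := le_abs_self _

end Duffing

theorem theorem3p3 (δ γ : ℝ) (y : ℝ → ℝ) (hy : IsDuffingSolution δ y) :
    (-(δ ^ 2 / 2) < γ → γ < 1 →
      TrivialSolutionStable (fun t => γ + y t ^ 2) ∧
        AllSolutionsBounded (fun t => γ + y t ^ 2)) ∧
    (γ < -(δ ^ 2 / 2) →
      ¬ TrivialSolutionStable (fun t => γ + y t ^ 2) ∧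
        ¬ AllSolutionsBounded (fun t => γ + y t ^ 2)) := by
  refine ⟨fun hγ hγ1 => ?_, fun hγ => ?_⟩
  · obtain ⟨C, hC, h⟩ := hy.exists_uniform_bound hγ hγ1
    exact ⟨trivialSolutionStable_of_uniform_bound hC h, fun ξ hξ => ⟨_, fun t => (h ξ hξ t).1⟩⟩
  · obtain ⟨ξ, hξ, hu⟩ := hy.exists_unbounded hγ
    refine ⟨hξ.not_trivialSolutionStable hu, fun hb => ?_⟩
    obtain ⟨C, hC⟩ := hb ξ hξ
    obtain ⟨t, -, ht⟩ := hu C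
    exact (hC t).not_gt ht
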